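/- Let $n\ge 4$, let $[m]=\{1,\dots,m\}$, and let $\mathfrak S_n$ be the symmetric group of $[n]$. Let $x_1,\dots,x_{n-1}$, $y_{i,j}$ ($i,j\in[n]$, $i\ne j$) and $z$ be independent indeterminates over $\mathbb R$. For $\sigma\in\mathfrak S_n$ put $$\mathrm{des}_x\,\sigma=\sum_{\substack{i\in[n-1]\\ \sigma(i)>\sigma(i+1)}}x_i,\qquad \mathrm{inv}_y\,\sigma=\sum_{\substack{1\le i<j\le n\\ \sigma(i)>\sigma(j)}}y_{i,j},\qquad \mathrm{fix}_z\,\sigma=\#\{i\in[n]:\sigma(i)=i\}\,z ,$$ and let $$\mathsf{DIF}(n)=\big(\mathrm{des}_x(\sigma\tau^{-1})+\mathrm{inv}_y(\sigma\tau^{-1})+\mathrm{fix}_z(\sigma\tau^{-1})\big)_{\sigma,\tau\in\mathfrak S_n},$$ regarded as a matrix over the field $K$ of rational functions over $\mathbb R$ in these indeterminates. Then $\mathsf{DIF}(n)$ is diagonalizable over $K$, and its spectrum (its set of eigenvalues in $K$) consists of the following five pairwise distinct elements, with the indicated multiplicities: - $\displaystyle \frac{n!}{2}\Big(\sum_{i\in[n-1]}x_i+\sum_{1\le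 i<j\le n}y_{i,j}\Big)+n!\,z$, with multiplicity $1$; - $\displaystyle -(n-2)!\Big(\sum_{i\in[n-1]}x_i+\sum_{1\le i<j\le n}(j-i)\,y_{i,j}-nz\Big)$, with multiplicity $n-1$; - $\displaystyle -(n-2)!\sum_{i\in[n-1]}x_i-(n-3)!\sum_{1\le i<j\le n}\big(n-2(j-i)\big)y_{i,j}$, with multiplicity $\binom{n-1}{2}$; - $(n-2)!\,n\,z$, with multiplicity $(n-1)(n-2)$; - $0$, with multiplicity $n!-\frac n2(3n-7)-3$. -/

import Mathlib

open scoped Nat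

noncomputable section

namespace PermStat

/-- The indeterminates `x_i` for `1 ≤ i ≤ n - 1`, `y_{i,j}` for `i ≠ j` in `[n]`, and `z`.
The set `[n]` is modelled by `Fin n` and `[n - 1]` by `Fin (n - 1)`, so indices start at `0`. -/
inductive Var (n : ℕ) : Type
  | x (i : Fin (n - 1)) : Var n
  | y (i j : Fin n) (h : i ≠ j) : Var n
  | z : Var n

/-- The polynomial ring `ℝ[x_1, …, x_{n-1}, y_{1,2}, …, y_{n,n-1}, z]`. -/
abbrev PolyRing (n : ℕ) : Type := MvPolynomial (Var n) ℝ

/-- The field of rational functions in the same indeterminates. -/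
abbrev RatField (n : ℕ) : Type := FractionRing (PolyRing n)

/-- The pairs `(i, j) ∈ [n]²` with `i < j`. -/
abbrev Pair (n : ℕ) : Type := {p : Fin n × Fin n // p.1 < p.2}

/-- The indeterminate `x_i`. -/
def xVar {n : ℕ} (i : Fin (n - 1)) : PolyRing n := MvPolynomial.X (Var.x i)

/-- The indeterminate `y_{i,j}` for `i < j`. -/
def yVar {n : ℕ} (p : Pair n) : PolyRing n :=
  MvPolynomial.X (Var.y p.1.1 p.1.2 p.2.ne)

/-- The indeterminate `z`. -/
def zVar (n : ℕ) : PolyRing n := MvPolynomial.X Var.z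

/-- The descent set: the `i ∈ [n - 1]` with `σ(i) > σ(i + 1)`. -/
def Des {n : ℕ} (σ : Equiv.Perm (Fin n)) : Finset (Fin (n - 1)) :=
  Finset.univ.filter fun i =>
    σ ⟨i.val + 1, by have := i.isLt; omega⟩ < σ ⟨i.val, by have := i.isLt; omega⟩

/-- The inversion set: the pairs `i < j` with `σ(i) > σ(j)`. -/
def Inv {n : ℕ} (σ : Equiv.Perm (Fin n)) : Finset (Pair n) :=
  Finset.univ.filter fun p => σ p.1.2 < σ p.1.1

/-- The fixed point set. -/
def Fix {n : ℕ} (σ : Equiv.Perm (Fin n)) : Finset (Fin n) :=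
  Finset.univ.filter fun i => σ i = i

/-- The descent multinomial `∑_{i ∈ Des σ} x_i`. -/
def desX {n : ℕ} (σ : Equiv.Perm (Fin n)) : PolyRing n := ∑ i ∈ Des σ, xVar i

/-- The inversion multinomial `∑_{(i,j) ∈ Inv σ} y_{i,j}`. -/
def invY {n : ℕ} (σ : Equiv.Perm (Fin n)) : PolyRing n := ∑ p ∈ Inv σ, yVar p

/-- The fixed point multinomial `#Fix(σ) z`. -/
def fixZ {n : ℕ} (σ : Equiv.Perm (Fin n)) : PolyRing n := ((Fix σ).card : PolyRing n) * zVar n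

/-- The matrix `(des_x(σ τ⁻¹) + inv_y(σ τ⁻¹) + fix_z(σ τ⁻¹))` indexed by pairs of permutations. -/
def DIF (n : ℕ) : Matrix (Equiv.Perm (Fin n)) (Equiv.Perm (Fin n)) (PolyRing n) :=
  Matrix.of fun σ τ => desX (σ * τ⁻¹) + invY (σ * τ⁻¹) + fixZ (σ * τ⁻¹)

/-- The same matrix, with entries regarded in the field of rational functions. -/
def DIFK (n : ℕ) : Matrix (Equiv.Perm (Fin n)) (Equiv.Perm (Fin n)) (RatField n) :=
  (DIF n).map (algebraMap (PolyRing n) (RatField n))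

/-- A square matrix over a field is diagonalizable if it is similar, over that field, to a
diagonal matrix. -/
def IsDiagonalizable {K ι : Type*} [Field K] [Fintype ι] [DecidableEq ι]
    (M : Matrix ι ι K) : Prop :=
  ∃ (P : Matrix ι ι K) (d : ι → K), IsUnit P.det ∧ P⁻¹ * M * P = Matrix.diagonal d

/-- The algebraic multiplicity of `a` as an eigenvalue of `M`. -/
def mult {K ι : Type*} [Field K] [Fintype ι] [DecidableEq ι]
    (M : Matrix ι ι K) (a : K) : ℕ :=
  M.charpoly.rootMultiplicity a

/-- The difference `j - i`, as a polynomial. -/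
def gap {n : ℕ} (p : Pair n) : PolyRing n :=
  ((p.1.2.val : ℕ) : PolyRing n) - ((p.1.1.val : ℕ) : PolyRing n)

/-- `(n!/2) (∑ x_i + ∑_{i<j} y_{i,j}) + n! z`. -/
def ev1 (n : ℕ) : PolyRing n :=
  MvPolynomial.C ((n ! : ℝ) / 2) * ((∑ i : Fin (n - 1), xVar i) + ∑ p : Pair n, yVar p)
    + (n ! : PolyRing n) * zVar n

/-- `-(n-2)! (∑ x_i + ∑_{i<j} (j-i) y_{i,j} - n z)`. -/
def ev2 (n : ℕ) : PolyRing n :=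
  -((n - 2)! : PolyRing n) *
    ((∑ i : Fin (n - 1), xVar i) + (∑ p : Pair n, gap p * yVar p) - (n : PolyRing n) * zVar n)

/-- `-(n-2)! ∑ x_i - (n-3)! ∑_{i<j} (n - 2(j-i)) y_{i,j}`. -/
def ev3 (n : ℕ) : PolyRing n :=
  -((n - 2)! : PolyRing n) * (∑ i : Fin (n - 1), xVar i)
    - ((n - 3)! : PolyRing n) * ∑ p : Pair n, ((n : PolyRing n) - 2 * gap p) * yVar p

/-- `(n-2)! n z`. -/
def ev4 (n : ℕ) : PolyRing n := ((n - 2)! : PolyRing n) * (n : PolyRing n) * zVar n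

end PermStat

end

/-!
Write `f = des_x + inv_y + fix_z`. The matrix acts on functions of a permutation by
`(M g) σ = ∑_π f(π) g(π⁻¹ σ)`, and its columns are combinations of the functions `1`,
`sgn (σ k - σ l)` and `[σ k = i]`. The proof diagonalizes `M` on the span of these functions by
explicit eigenvectors, and never needs their linear dependencies.

Put `s(u, v) = sgn (u - v)`, let `T(u) = ∑_v s(u, v)`, and let
`t(u, v) = n s(u, v) - (T(u) - T(v))`, which is alternating with zero row sums. Three sums over
the symmetric group carry the computation, for `a ≠ b` and `u` with `∑ u = 0`:

* `∑_π s(π a, π b) u(π⁻¹ p) = (n-2)! (u(a) - u(b)) T(p)` (`sum_perm_apply_sub`);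
* `∑_π s(π a, π b) t(π⁻¹ p, π⁻¹ q) = 2 (n-3)! t(a, b) t(p, q)` (`sum_perm_apply_mul_alternating`);
* `∑_π #Fix(π) u(π⁻¹ p) = (n-2)! n u(p)` (`sum_perm_card_fixed_mul`), while the same sum with
  `t(π⁻¹ p, π⁻¹ q)` vanishes.

Since `[π a > π b] = (1 + s(π a, π b)) / 2`, the functions `1`, `T(σ k)`, `t(σ k, σ l)`, and
`u(σ k)` for `u` that has sum zero and pairs to zero with the weights, are eigenvectors for the
first four eigenvalues, in the order `ev1`, `ev2`, `ev3`, `ev4`. They span the columns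
(`col_statMatrix_mem`), and a matrix whose columns are combinations of eigenvectors with nonzero
eigenvalues is diagonalizable (`exists_diagonalization`).

For the multiplicities no dimension is counted. The eigenvalue `ev1` comes from a single vector,
so it is simple. The trace of `M` is `n! n z`, and comparing the coefficients of the `x_i`, of
`y_{0,2}` and of `z` with those of `∑ m_i ev_i` gives three linear equations that determine the
other three multiplicities (`mults_of_trace`); the kernel takes the rest.
-/

/-! ### Diagonalization from eigenvectors that span the columns -/

namespace PermStat
open Matrix

theorem sum_eq_sum_card_filter {K ι A : Type*} [Fintype ι] [DecidableEq K] [AddCommMonoid A]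
    {d : ι → K} {t : Finset K} (ht : ∀ i, d i ∈ t) (F : K → A) :
    ∑ i, F (d i) = ∑ a ∈ t, (Finset.univ.filter fun i => d i = a).card • F a := by
  rw [← Finset.sum_fiberwise_of_maps_to (g := d) (t := t) fun i _ => ht i]
  refine Finset.sum_congr rfl fun a _ => ?_
  rw [← Finset.sum_const]
  exact Finset.sum_congr rfl fun i hi => by rw [(Finset.mem_filter.1 hi).2]

section Diagonalization
variable {K ι : Type*} [Field K] [Fintype ι]

/-- A spanning set `S` of vectors contains a basis, that is, the columns of an invertible
matrix. -/
theorem exists_isUnit_det_col_mem [DecidableEq ι] (S : Set (ι → K))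
    (h : Submodule.span K S = ⊤) :
    ∃ P : Matrix ι ι K, IsUnit P.det ∧ ∀ j, P.col j ∈ S := by
  obtain ⟨b, hbs, hbspan, hbli⟩ := exists_linearIndependent K S
  let B : Module.Basis b K (ι → K) := Module.Basis.mk hbli (by
    rw [Subtype.range_coe, hbspan, h])
  let e : b ≃ ι := B.indexEquiv (Pi.basisFun K ι)
  refine ⟨Matrix.of fun i j => ((e.symm j : b) : ι → K) i, ?_, fun j => hbs (e.symm j).2⟩
  rw [← Matrix.isUnit_iff_isUnit_det, ← Matrix.linearIndependent_cols_iff_isUnit]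
  exact hbli.comp _ e.symm.injective

/-- If the columns of `M` lie in the span of a set `S` of eigenvectors with nonzero eigenvalues,
then `S` and the kernel of `M` span the whole space: `M` maps the span of `S` onto itself, so any
vector differs from one in that span by an element of the kernel. -/
theorem span_union_ker_eq_top (M : Matrix ι ι K) (S : Set (ι → K))
    (hS : ∀ v ∈ S, ∃ a : K, a ≠ 0 ∧ M *ᵥ v = a • v)
    (hcol : ∀ j, M.col j ∈ Submodule.span K S) :
    Submodule.span K (S ∪ {v | M *ᵥ v = 0}) = ⊤ := by
  have hsurj : ∀ w ∈ Submodule.span K S, ∃ w' ∈ Submodule.span K S, M *ᵥ w' = w := by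
    intro w hw
    induction hw using Submodule.span_induction with
    | mem v hv =>
      obtain ⟨a, ha, hav⟩ := hS v hv
      refine ⟨a⁻¹ • v, Submodule.smul_mem _ _ (Submodule.subset_span hv), ?_⟩
      rw [Matrix.mulVec_smul, hav, smul_smul, inv_mul_cancel₀ ha, one_smul]
    | zero => exact ⟨0, Submodule.zero_mem _, Matrix.mulVec_zero _⟩
    | add x y _ _ hx hy =>
      obtain ⟨x', hx', rfl⟩ := hx
      obtain ⟨y', hy', rfl⟩ := hy
      exact ⟨x' + y', Submodule.add_mem _ hx' hy', Matrix.mulVec_add _ _ _⟩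
    | smul c x _ hx =>
      obtain ⟨x', hx', rfl⟩ := hx
      exact ⟨c • x', Submodule.smul_mem _ _ hx', Matrix.mulVec_smul _ _ _⟩
  rw [eq_top_iff]
  intro g _
  have hg : M *ᵥ g ∈ Submodule.span K S := by
    have : M *ᵥ g = ∑ j, g j • M.col j := by
      ext i
      simp [Matrix.mulVec, dotProduct, Finset.sum_apply, mul_comm]
    rw [this]
    exact Submodule.sum_mem _ fun j _ => Submodule.smul_mem _ _ (hcol j)
  obtain ⟨w, hw, hMw⟩ := hsurj _ hg
  rw [← sub_add_cancel g w]
  refine Submodule.add_mem _ (Submodule.subset_span (Or.inr ?_))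
    (Submodule.span_mono Set.subset_union_left hw)
  rw [Set.mem_ofPred_eq, Matrix.mulVec_sub, hMw, sub_self]

variable [DecidableEq ι]

/-- Let `v₁` be an eigenvector for `a₁ ≠ 0`, and let the columns of `M` be combinations of `v₁` and
of eigenvectors for eigenvalues in a set `L` that contains neither `0` nor `a₁`. Then `M` is
diagonalizable with eigenvalues in `{a₁, 0} ∪ L`, and `a₁` occurs exactly once. -/
theorem exists_diagonalization [DecidableEq K] (M : Matrix ι ι K) (v₁ : ι → K) (a₁ : K)
    (L : Set K) (hv₁ : M *ᵥ v₁ = a₁ • v₁) (hv₁0 : v₁ ≠ 0) (ha₁ : a₁ ≠ 0)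
    (hL0 : (0 : K) ∉ L) (hL₁ : a₁ ∉ L)
    (hcol : ∀ j, M.col j ∈ Submodule.span K (insert v₁ {v | ∃ a ∈ L, M *ᵥ v = a • v})) :
    ∃ (P : Matrix ι ι K) (d : ι → K), IsUnit P.det ∧ M * P = P * diagonal d ∧
      (∀ i, d i = a₁ ∨ d i = 0 ∨ d i ∈ L) ∧
      (Finset.univ.filter fun i => d i = a₁).card = 1 := by
  have hne : ∀ a ∈ L, a ≠ 0 := fun a ha h => hL0 (h ▸ ha)
  have hspan := span_union_ker_eq_top M _ (by
    rintro v (rfl | ⟨a, ha, hv⟩)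
    · exact ⟨a₁, ha₁, hv₁⟩
    · exact ⟨a, hne a ha, hv⟩) hcol
  obtain ⟨P, hP, hPS⟩ := exists_isUnit_det_col_mem _ hspan
  have hd : ∀ j, ∃ a, M *ᵥ P.col j = a • P.col j ∧ (a = a₁ ∨ a = 0 ∨ a ∈ L) ∧
      (a = a₁ → P.col j = v₁) := by
    intro j
    rcases hPS j with (h | ⟨a, ha, hv⟩) | h
    · exact ⟨a₁, by rw [h, hv₁], Or.inl rfl, fun _ => h⟩
    · exact ⟨a, hv, Or.inr (Or.inr ha), fun h => absurd (h ▸ ha) hL₁⟩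
    · exact ⟨0, by rw [zero_smul]; exact h, Or.inr (Or.inl rfl), fun h => absurd h.symm ha₁⟩
  choose d hdv hdL hd₁ using hd
  have hMP : M * P = P * diagonal d := by
    ext i j
    rw [Matrix.mul_diagonal]
    have := congrFun (hdv j) i
    simp only [Matrix.mulVec, dotProduct, Pi.smul_apply, smul_eq_mul] at this
    rw [Matrix.mul_apply]
    exact this.trans (mul_comm _ _)
  refine ⟨P, d, hP, hMP, hdL, le_antisymm ?_ ?_⟩
  · have hinj : Function.Injective P.col :=
      (Matrix.linearIndependent_cols_iff_isUnit.2
        ((Matrix.isUnit_iff_isUnit_det P).2 hP)).injective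
    rw [Finset.card_le_one]
    intro i hi j hj
    simp only [Finset.mem_filter, Finset.mem_univ, true_and] at hi hj
    exact hinj ((hd₁ i hi).trans (hd₁ j hj).symm)
  · -- in the basis `P`, the eigenvector `v₁` is supported on the `i` with `d i = a₁`
    rw [Nat.one_le_iff_ne_zero, Finset.card_ne_zero, Finset.filter_nonempty_iff]
    by_contra! hno
    have hy : diagonal d *ᵥ (P⁻¹ *ᵥ v₁) = a₁ • (P⁻¹ *ᵥ v₁) := by
      rw [← Matrix.mulVec_smul, ← hv₁, Matrix.mulVec_mulVec, Matrix.mulVec_mulVec,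
        ← Matrix.nonsing_inv_mul_cancel_left P (diagonal d * P⁻¹) hP, ← Matrix.mul_assoc P, ← hMP,
        Matrix.mul_nonsing_inv_cancel_right _ _ hP]
    have hy0 : P⁻¹ *ᵥ v₁ = 0 := by
      ext i
      have := congrFun hy i
      rw [Matrix.mulVec_diagonal, Pi.smul_apply, smul_eq_mul] at this
      by_contra h
      exact hno i (Finset.mem_univ i) (mul_right_cancel₀ h this)
    apply hv₁0
    rw [← Matrix.one_mulVec v₁, ← Matrix.mul_nonsing_inv P hP, ← Matrix.mulVec_mulVec, hy0,
      Matrix.mulVec_zero]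

variable {M P : Matrix ι ι K} {d : ι → K}

theorem inv_mul_mul_eq_diagonal (hP : IsUnit P.det) (h : M * P = P * diagonal d) :
    P⁻¹ * M * P = diagonal d := by
  rw [Matrix.mul_assoc, h, Matrix.nonsing_inv_mul_cancel_left _ _ hP]

theorem eq_mul_diagonal_mul_inv (hP : IsUnit P.det) (h : M * P = P * diagonal d) :
    M = P * diagonal d * P⁻¹ := by
  rw [← h, Matrix.mul_nonsing_inv_cancel_right _ _ hP]

theorem charpoly_eq_prod (hP : IsUnit P.det) (h : M * P = P * diagonal d) :
    M.charpoly = ∏ i, (Polynomial.X - Polynomial.C (d i)) := by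
  obtain ⟨u, rfl⟩ := (Matrix.isUnit_iff_isUnit_det P).2 hP
  rw [eq_mul_diagonal_mul_inv hP h, Matrix.charpoly_units_conj, Matrix.charpoly_diagonal]

theorem trace_eq_sum (hP : IsUnit P.det) (h : M * P = P * diagonal d) :
    M.trace = ∑ i, d i := by
  rw [eq_mul_diagonal_mul_inv hP h, Matrix.trace_mul_comm,
    Matrix.nonsing_inv_mul_cancel_left _ _ hP, Matrix.trace_diagonal]

theorem mult_eq_card [DecidableEq K] (hP : IsUnit P.det) (h : M * P = P * diagonal d) (a : K) :
    mult M a = (Finset.univ.filter fun i => d i = a).card := by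
  have hroots : M.charpoly.roots = Finset.univ.val.map d := by
    rw [charpoly_eq_prod hP h, Polynomial.roots_prod _ _
      (Finset.prod_ne_zero_iff.2 fun i _ => Polynomial.X_sub_C_ne_zero (d i))]
    simp
  rw [mult, ← Polynomial.count_roots, hroots, Multiset.count_map]
  simp [Finset.card, eq_comm]

theorem spectrum_eq_range (hP : IsUnit P.det) (h : M * P = P * diagonal d) :
    spectrum K M = Set.range d := by
  ext a
  rw [Matrix.mem_spectrum_iff_isRoot_charpoly, charpoly_eq_prod hP h, Polynomial.IsRoot.def,
    Polynomial.eval_prod, Finset.prod_eq_zero_iff]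
  simp [sub_eq_zero, eq_comm]

end Diagonalization
end PermStat

/-! ### Sums over the symmetric group -/

namespace PermStat
open Equiv

section PermSums
variable {ι : Type*} [Fintype ι] [DecidableEq ι]

/-- The number of permutations with `k` prescribed values. -/
theorem card_perm_extending {k : ℕ} {x y : Fin k → ι} (hx : Function.Injective x)
    (hy : Function.Injective y) :
    (Finset.univ.filter fun π : Perm ι => ∀ i, π (x i) = y i).card = (Fintype.card ι - k)! := by
  classical
  let e₀ : Set.range x ≃ Set.range y :=
    (Equiv.ofInjective x hx).symm.trans (Equiv.ofInjective y hy)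
  have he₀ : ∀ i, (e₀ ⟨x i, i, rfl⟩ : ι) = y i := by
    intro i
    have : (Equiv.ofInjective x hx).symm ⟨x i, i, rfl⟩ = i := (Equiv.symm_apply_eq _).2 rfl
    simp [e₀, this]
  have e₁ : {π : Perm ι // ∀ i, π (x i) = y i} ≃ {π : Perm ι // ∀ v : Set.range x, π v = e₀ v} :=
    Equiv.subtypeEquivRight fun π => by
      constructor
      · rintro h ⟨_, i, rfl⟩
        rw [he₀, ← h]
      · intro h i
        rw [← he₀, ← h ⟨x i, i, rfl⟩]
  have hc : ∀ {w : Fin k → ι}, Function.Injective w →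
      Fintype.card ((Set.range w)ᶜ : Set ι) = Fintype.card ι - k := by
    intro w hw
    rw [Fintype.card_compl_set, Set.card_range_of_injective hw, Fintype.card_fin]
  rw [← Fintype.card_subtype, Fintype.card_congr (e₁.trans (Equiv.Set.compl e₀)),
    Fintype.card_equiv (Fintype.equivOfCardEq ((hc hx).trans (hc hy).symm)), hc hx]

theorem card_perm_one (a v : ι) :
    (Finset.univ.filter fun π : Perm ι => π a = v).card = (Fintype.card ι - 1)! := by
  simpa using card_perm_extending (x := ![a]) (y := ![v])
    (Function.injective_of_subsingleton _) (Function.injective_of_subsingleton _)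

theorem card_perm_two {a b p v : ι} (hab : a ≠ b) (hpv : p ≠ v) :
    (Finset.univ.filter fun π : Perm ι => π a = p ∧ π b = v).card = (Fintype.card ι - 2)! := by
  simpa [Fin.forall_fin_two] using card_perm_extending (x := ![a, b]) (y := ![p, v])
    (by simp [Function.Injective, Fin.forall_fin_two, hab, hab.symm])
    (by simp [Function.Injective, Fin.forall_fin_two, hpv, hpv.symm])

theorem card_perm_three {a j b p q v : ι} (haj : a ≠ j) (hab : a ≠ b) (hjb : j ≠ b)
    (hpq : p ≠ q) (hpv : p ≠ v) (hqv : q ≠ v) :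
    (Finset.univ.filter fun π : Perm ι => π a = p ∧ π j = q ∧ π b = v).card =
      (Fintype.card ι - 3)! := by
  simpa [Fin.forall_fin_succ] using card_perm_extending (x := ![a, j, b]) (y := ![p, q, v])
    (by simp [Function.Injective, Fin.forall_fin_succ, haj, haj.symm, hab, hab.symm, hjb,
      hjb.symm])
    (by simp [Function.Injective, Fin.forall_fin_succ, hpq, hpq.symm, hpv, hpv.symm, hqv,
      hqv.symm])

theorem filter_inv_apply_eq (π : Perm ι) :
    (Finset.univ.filter fun i => π⁻¹ i = i) = Finset.univ.filter fun i => π i = i := by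
  ext i
  simp only [Finset.mem_filter, Finset.mem_univ, true_and]
  rw [Perm.inv_eq_iff_eq]
  exact eq_comm

variable {K : Type*} [Field K]

theorem sum_perm_apply (a : ι) (g : ι → K) :
    ∑ π : Perm ι, g (π a) = (Fintype.card ι - 1)! * ∑ v, g v := by
  have h1 : ∀ v : ι, (∑ π : Perm ι, if π a = v then g v else 0) = (Fintype.card ι - 1)! * g v := by
    intro v
    rw [← Finset.sum_filter, Finset.sum_const, nsmul_eq_mul, card_perm_one]
  rw [Finset.mul_sum, ← Finset.sum_congr rfl fun v _ => h1 v, Finset.sum_comm]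
  simp

/-- Given `π a = p`, the value `π b` is equidistributed over the elements other than `p`. -/
theorem sum_perm_apply_of_one {a b : ι} (hab : a ≠ b) (p : ι) (g : ι → K) :
    (∑ π : Perm ι, if π a = p then g (π b) else 0) = (Fintype.card ι - 2)! * ((∑ v, g v) - g p) := by
  have h1 : ∀ v : ι, (∑ π : Perm ι, if π a = p ∧ π b = v then g v else 0) =
      (Fintype.card ι - 2)! * (g v - if v = p then g p else 0) := by
    intro v
    by_cases hv : v = p
    · subst hv
      rw [Finset.sum_eq_zero]
      · simp
      · rintro π -
        rw [if_neg]
        rintro ⟨h, h'⟩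
        exact hab (π.injective (h.trans h'.symm))
    · rw [← Finset.sum_filter, Finset.sum_const, nsmul_eq_mul,
        card_perm_two hab (Ne.symm hv), if_neg hv, sub_zero]
  have h2 : (∑ v, g v) - g p = ∑ v, (g v - if v = p then g p else 0) := by
    simp [Finset.sum_sub_distrib]
  rw [h2, Finset.mul_sum, ← Finset.sum_congr rfl fun v _ => h1 v, Finset.sum_comm]
  refine Finset.sum_congr rfl fun π _ => ?_
  by_cases h : π a = p <;> simp [h]

theorem sum_perm_apply_of_two {a j b : ι} (haj : a ≠ j) (hab : a ≠ b) (hjb : j ≠ b) {p q : ι}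
    (hpq : p ≠ q) (g : ι → K) :
    (∑ π : Perm ι, if π a = p ∧ π j = q then g (π b) else 0) =
      (Fintype.card ι - 3)! * ((∑ v, g v) - g p - g q) := by
  have h1 : ∀ v : ι, (∑ π : Perm ι, if (π a = p ∧ π j = q) ∧ π b = v then g v else 0) =
      (Fintype.card ι - 3)! * (g v - (if v = p then g p else 0) - if v = q then g q else 0) := by
    intro v
    by_cases hv : v = p ∨ v = q
    · rw [Finset.sum_eq_zero]
      · rcases hv with rfl | rfl
        · simp [hpq]
        · simp [hpq.symm]
      · rintro π -
        rw [if_neg]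
        rintro ⟨⟨h, h'⟩, h''⟩
        rcases hv with rfl | rfl
        · exact hab (π.injective (h.trans h''.symm))
        · exact hjb (π.injective (h'.trans h''.symm))
    · push Not at hv
      simp only [and_assoc]
      rw [← Finset.sum_filter, Finset.sum_const, nsmul_eq_mul,
        card_perm_three haj hab hjb hpq hv.1.symm hv.2.symm, if_neg hv.1, if_neg hv.2, sub_zero,
        sub_zero]
  have h2 : (∑ v, g v) - g p - g q =
      ∑ v, (g v - (if v = p then g p else 0) - if v = q then g q else 0) := by
    simp [Finset.sum_sub_distrib]
  rw [h2, Finset.mul_sum, ← Finset.sum_congr rfl fun v _ => h1 v, Finset.sum_comm]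
  refine Finset.sum_congr rfl fun π _ => ?_
  by_cases h : π a = p ∧ π j = q <;> simp [h]

theorem sum_perm_card_fixed [Nonempty ι] :
    ∑ π : Perm ι, ((Finset.univ.filter fun i => π i = i).card : K) = (Fintype.card ι)! := by
  simp_rw [Finset.natCast_card_filter]
  rw [Finset.sum_comm]
  simp_rw [← Finset.natCast_card_filter, card_perm_one]
  rw [Finset.sum_const, Finset.card_univ, nsmul_eq_mul, ← Nat.cast_mul,
    Nat.mul_factorial_pred Fintype.card_ne_zero]

theorem sum_perm_card_fixed_mul (hcard : 2 ≤ Fintype.card ι) {u : ι → K} (hu : ∑ v, u v = 0)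
    (p : ι) :
    ∑ π : Perm ι, ((Finset.univ.filter fun i => π i = i).card : K) * u (π⁻¹ p) =
      (Fintype.card ι - 2)! * Fintype.card ι * u p := by
  have hl : ∀ l, (∑ π : Perm ι, if π l = l then u (π p) else 0) =
      (Fintype.card ι - 2)! * (if l = p then Fintype.card ι * u p else 0) -
        (Fintype.card ι - 2)! * u l := by
    intro l
    by_cases h : l = p
    · subst h
      have hfact : ((Fintype.card ι - 1)! : K) =
          (Fintype.card ι - 1) * (Fintype.card ι - 2)! := by
        obtain ⟨m, hm⟩ : ∃ m, Fintype.card ι = m + 2 := ⟨_, (Nat.sub_add_cancel hcard).symm⟩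
        rw [hm, show m + 2 - 1 = m + 1 by omega, show m + 2 - 2 = m by omega, Nat.factorial_succ]
        push_cast
        ring
      rw [Finset.sum_congr rfl fun π _ => show _ = if π l = l then u l else 0 by
        split_ifs with h
        · rw [h]
        · rfl]
      rw [← Finset.sum_filter, Finset.sum_const, nsmul_eq_mul, card_perm_one, hfact, if_pos rfl]
      ring
    · rw [sum_perm_apply_of_one h, hu, if_neg h]
      ring
  rw [← Equiv.sum_comp (Equiv.inv (Perm ι))]
  simp only [Equiv.inv_apply, inv_inv, filter_inv_apply_eq]
  simp_rw [Finset.natCast_card_filter, Finset.sum_mul]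
  rw [Finset.sum_comm]
  simp_rw [ite_mul, one_mul, zero_mul]
  simp_rw [hl, Finset.sum_sub_distrib, ← Finset.mul_sum, hu]
  simp
  ring

variable [CharZero K]

/-- Swapping the values at `a` and `b` reverses the sign of an alternating function of them. -/
theorem sum_perm_eq_zero_of_swap {s : ι → ι → K} (hs : ∀ u v, s u v = -s v u) (a b : ι)
    (w : Perm ι → K) (hw : ∀ π, w (π * swap a b) = w π) :
    ∑ π : Perm ι, w π * s (π a) (π b) = 0 := by
  have h := Equiv.sum_comp (Equiv.mulRight (swap a b)) fun π : Perm ι => w π * s (π a) (π b)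
  simp only [Equiv.coe_mulRight, hw, Perm.coe_mul, Function.comp_apply, swap_apply_left,
    swap_apply_right] at h
  rw [← self_eq_neg, ← Finset.sum_neg_distrib]
  conv_lhs => rw [← h]
  exact Finset.sum_congr rfl fun π _ => by rw [hs]; ring

theorem sum_perm_apply_sub {s : ι → ι → K} (hs : ∀ u v, s u v = -s v u) {a b : ι} (hab : a ≠ b)
    (p : ι) (u : ι → K) :
    ∑ π : Perm ι, s (π a) (π b) * u (π⁻¹ p) = (Fintype.card ι - 2)! * (u a - u b) * ∑ v, s p v := by
  have hdiag : ∀ v, s v v = 0 := fun v => self_eq_neg.1 (hs v v)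
  have key : ∀ i, (∑ π : Perm ι, (if π i = p then 1 else 0) * s (π a) (π b)) =
      (Fintype.card ι - 2)! * ((if i = a then 1 else 0) - if i = b then 1 else 0) * ∑ v, s p v := by
    intro i
    by_cases hia : i = a
    · subst hia
      have := sum_perm_apply_of_one hab p (s p)
      rw [hdiag, sub_zero] at this
      rw [if_pos rfl, if_neg hab, sub_zero, mul_one, ← this]
      refine Finset.sum_congr rfl fun π _ => ?_
      split_ifs with h
      · rw [h, one_mul]
      · rw [zero_mul]
    by_cases hib : i = b
    · subst hib
      have := sum_perm_apply_of_one hab.symm p (s p)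
      rw [hdiag, sub_zero] at this
      rw [if_pos rfl, if_neg hia, zero_sub, mul_neg_one, neg_mul, ← this, ← Finset.sum_neg_distrib]
      refine Finset.sum_congr rfl fun π _ => ?_
      split_ifs with h
      · rw [h, hs, one_mul]
      · rw [zero_mul, neg_zero]
    · rw [if_neg hia, if_neg hib, sub_zero, mul_zero, zero_mul]
      refine sum_perm_eq_zero_of_swap hs a b (fun π => if π i = p then 1 else 0) fun π => ?_
      rw [Perm.mul_apply, swap_apply_of_ne_of_ne hia hib]
  have hu : ∀ π : Perm ι, u (π⁻¹ p) = ∑ i, u i * if π i = p then 1 else 0 := by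
    intro π
    simp [← Perm.eq_inv_iff_eq]
  simp_rw [hu, Finset.mul_sum]
  rw [Finset.sum_comm]
  have : ∀ i, (∑ π : Perm ι, s (π a) (π b) * (u i * if π i = p then 1 else 0)) =
      u i * ((Fintype.card ι - 2)! *
        ((if i = a then 1 else 0) - if i = b then 1 else 0) * ∑ v, s p v) := by
    intro i
    rw [← key, Finset.mul_sum]
    exact Finset.sum_congr rfl fun π _ => by ring
  rw [Finset.sum_congr rfl fun i _ => this i, ← Finset.mul_sum]
  simp only [← mul_assoc, ← Finset.sum_mul]
  simp only [mul_sub, sub_mul, Finset.sum_sub_distrib]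
  simp
  ring

/-- The correlation of `s (π a) (π b)` with prescribed values at two places `i` and `j`. By
`sum_perm_eq_zero_of_swap` only places among `a` and `b` contribute; the last summand corrects
the case `{i, j} = {a, b}`. -/
theorem sum_perm_apply_pair {s : ι → ι → K} (hs : ∀ u v, s u v = -s v u)
    (hcard : 3 ≤ Fintype.card ι) {a b i j p q : ι} (hab : a ≠ b) (hij : i ≠ j) (hpq : p ≠ q) :
    (∑ π : Perm ι, (if π i = p ∧ π j = q then 1 else 0) * s (π a) (π b)) =
      (Fintype.card ι - 3)! *
        (((if i = a then 1 else 0) - if i = b then 1 else 0) * ((∑ v, s p v) - s p q) +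
          ((if j = a then 1 else 0) - if j = b then 1 else 0) * ((∑ v, s q v) - s q p) +
          ((if i = a then 1 else 0) * (if j = b then 1 else 0) -
            (if i = b then 1 else 0) * if j = a then 1 else 0) *
            (Fintype.card ι * s p q - ((∑ v, s p v) - ∑ v, s q v))) := by
  have hdiag : ∀ v, s v v = 0 := fun v => self_eq_neg.1 (hs v v)
  -- the sum when exactly one of `a`, `b` is among the prescribed places
  have hone : ∀ {i j b p q : ι}, i ≠ j → b ≠ i → b ≠ j → p ≠ q →
      (∑ π : Perm ι, (if π i = p ∧ π j = q then 1 else 0) * s (π i) (π b)) =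
        (Fintype.card ι - 3)! * ((∑ v, s p v) - s p q) := by
    intro i j b p q hij hbi hbj hpq
    have := sum_perm_apply_of_two hij hbi.symm hbj.symm hpq (s p)
    rw [hdiag, sub_zero] at this
    rw [← this]
    refine Finset.sum_congr rfl fun π _ => ?_
    split_ifs with h
    · rw [h.1, one_mul]
    · rw [zero_mul]
  have hflip : ∀ {i j a b p q : ι},
      (∑ π : Perm ι, (if π i = p ∧ π j = q then 1 else 0) * s (π a) (π b)) =
        -∑ π : Perm ι, (if π i = p ∧ π j = q then 1 else 0) * s (π b) (π a) := by
    intro i j a b p q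
    rw [← Finset.sum_neg_distrib]
    exact Finset.sum_congr rfl fun π _ => by rw [hs (π a)]; ring
  have hcomm : ∀ {i j a b p q : ι},
      (∑ π : Perm ι, (if π i = p ∧ π j = q then 1 else 0) * s (π a) (π b)) =
        ∑ π : Perm ι, (if π j = q ∧ π i = p then 1 else 0) * s (π a) (π b) := by
    intro i j a b p q
    simp only [and_comm]
  have hboth : ∀ {i j p q : ι}, i ≠ j → p ≠ q →
      (∑ π : Perm ι, (if π i = p ∧ π j = q then 1 else 0) * s (π i) (π j)) =
        (Fintype.card ι - 3)! * ((Fintype.card ι - 2) * s p q) := by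
    intro i j p q hij hpq
    have hfact : ((Fintype.card ι - 2)! : K) =
        (Fintype.card ι - 2) * (Fintype.card ι - 3)! := by
      obtain ⟨m, hm⟩ : ∃ m, Fintype.card ι = m + 3 := ⟨_, (Nat.sub_add_cancel hcard).symm⟩
      rw [hm, show m + 3 - 2 = m + 1 by omega, show m + 3 - 3 = m by omega, Nat.factorial_succ]
      push_cast
      ring
    calc _ = ∑ π : Perm ι, if π i = p ∧ π j = q then s p q else 0 := by
          refine Finset.sum_congr rfl fun π _ => ?_
          split_ifs with h
          · rw [h.1, h.2, one_mul]
          · rw [zero_mul]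
      _ = _ := by
          rw [← Finset.sum_filter, Finset.sum_const, nsmul_eq_mul, card_perm_two hij hpq, hfact]
          ring
  by_cases hia : i = a
  · subst hia
    by_cases hjb : j = b
    · subst hjb
      rw [hboth hij hpq, hs q p]
      simp only [if_true, if_neg hij, if_neg hij.symm]
      ring
    · rw [hone hij hab.symm (Ne.symm hjb) hpq]
      simp only [if_true, if_neg hab, if_neg hij.symm, if_neg hjb]
      ring
  by_cases hib : i = b
  · subst hib
    by_cases hja : j = a
    · subst hja
      rw [hflip, hboth hij hpq, hs q p]
      simp only [if_true, if_neg hij, if_neg hij.symm]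
      ring
    · rw [hflip, hone hij hab (Ne.symm hja) hpq]
      simp only [if_true, if_neg hab.symm, if_neg hij.symm, if_neg hja]
      ring
  simp only [if_neg hia, if_neg hib]
  by_cases hja : j = a
  · subst hja
    rw [hcomm, hone hij.symm hab.symm (Ne.symm hib) hpq.symm]
    simp only [if_true, if_neg hab]
    ring
  by_cases hjb : j = b
  · subst hjb
    rw [hcomm, hflip, hone hij.symm hab (Ne.symm hia) hpq.symm]
    simp only [if_true, if_neg hab.symm]
    ring
  simp only [if_neg hja, if_neg hjb]
  rw [sum_perm_eq_zero_of_swap hs a b (fun π => if π i = p ∧ π j = q then 1 else 0)]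
  · ring
  · intro π
    rw [Perm.mul_apply, Perm.mul_apply, swap_apply_of_ne_of_ne hia hib,
      swap_apply_of_ne_of_ne hja hjb]

/-- For alternating `s` and `t`, where `t` has zero row sums, summing over all permutations
separates the variables: only the part of `s` with zero row sums survives, because in
`sum_perm_apply_pair` all but the last summand depend on one of `i`, `j` only. -/
theorem sum_perm_apply_mul_alternating {s t : ι → ι → K} (hs : ∀ u v, s u v = -s v u)
    (ht : ∀ u v, t u v = -t v u) (ht0 : ∀ u, ∑ v, t u v = 0) (hcard : 3 ≤ Fintype.card ι)
    {a b : ι} (hab : a ≠ b) (p q : ι) :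
    ∑ π : Perm ι, s (π a) (π b) * t (π⁻¹ p) (π⁻¹ q) =
      2 * (Fintype.card ι - 3)! * t a b *
        (Fintype.card ι * s p q - ((∑ v, s p v) - ∑ v, s q v)) := by
  have hsd : ∀ v, s v v = 0 := fun v => self_eq_neg.1 (hs v v)
  have htd : ∀ v, t v v = 0 := fun v => self_eq_neg.1 (ht v v)
  by_cases hpq : p = q
  · subst hpq
    simp [hsd, htd]
  have ht0' : ∀ v, ∑ u, t u v = 0 := fun v => by
    rw [Finset.sum_congr rfl fun u _ => ht u v, Finset.sum_neg_distrib, ht0, neg_zero]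
  have hexp : ∀ π : Perm ι, t (π⁻¹ p) (π⁻¹ q) =
      ∑ i, ∑ j, t i j * if π i = p ∧ π j = q then 1 else 0 := by
    intro π
    simp [← Perm.eq_inv_iff_eq, ite_and]
  set X := (∑ v, s p v) - s p q
  set Y := (∑ v, s q v) - s q p
  set Z := Fintype.card ι * s p q - ((∑ v, s p v) - ∑ v, s q v)
  have hterm : ∀ i j, (∑ π : Perm ι, s (π a) (π b) *
      (t i j * if π i = p ∧ π j = q then 1 else 0)) =
        (Fintype.card ι - 3)! *
          (((if i = a then 1 else 0) - if i = b then 1 else 0) * t i j * X +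
          ((if j = a then 1 else 0) - if j = b then 1 else 0) * t i j * Y +
          ((if i = a then 1 else 0) * (if j = b then 1 else 0) -
            (if i = b then 1 else 0) * if j = a then 1 else 0) * t i j * Z) := by
    intro i j
    by_cases hij : i = j
    · subst hij
      simp [htd]
    · have := congrArg (t i j * ·) (sum_perm_apply_pair hs hcard hab hij hpq)
      simp only [Finset.mul_sum] at this
      rw [Finset.sum_congr rfl fun π _ => show _ = t i j *
        ((if π i = p ∧ π j = q then 1 else 0) * s (π a) (π b)) by ring, this]
      ring
  simp_rw [hexp, Finset.mul_sum]
  rw [Finset.sum_comm]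
  simp_rw [Finset.sum_comm (s := (Finset.univ : Finset (Perm ι)))]
  simp_rw [hterm, ← Finset.mul_sum, Finset.sum_add_distrib, ← Finset.sum_mul, sub_mul,
    Finset.sum_sub_distrib]
  simp [ht0, ht0', ite_mul]
  rw [ht b a]
  ring

theorem sum_perm_card_fixed_mul_alternating {t : ι → ι → K} (ht : ∀ u v, t u v = -t v u)
    (ht0 : ∀ u, ∑ v, t u v = 0) (p q : ι) :
    ∑ π : Perm ι, ((Finset.univ.filter fun i => π i = i).card : K) * t (π⁻¹ p) (π⁻¹ q) = 0 := by
  have htd : ∀ v, t v v = 0 := fun v => self_eq_neg.1 (ht v v)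
  by_cases hpq : p = q
  · subst hpq
    simp [htd]
  have key : ∀ {p q : ι}, p ≠ q → (∑ π : Perm ι, if π p = p then t (π p) (π q) else 0) = 0 := by
    intro p q hpq
    have := sum_perm_apply_of_one hpq p (t p)
    rw [ht0, htd, sub_zero, mul_zero] at this
    refine (Finset.sum_congr rfl fun π _ => ?_).trans this
    split_ifs with h
    · rw [h]
    · rfl
  have hl : ∀ l, (∑ π : Perm ι, if π l = l then t (π p) (π q) else 0) = 0 := by
    intro l
    by_cases hlp : l = p
    · subst hlp
      exact key hpq
    by_cases hlq : l = q
    · subst hlq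
      rw [← neg_eq_zero, ← Finset.sum_neg_distrib]
      refine (Finset.sum_congr rfl fun π _ => ?_).trans (key (Ne.symm hpq))
      split_ifs
      · rw [ht, neg_neg]
      · exact neg_zero
    · refine (Finset.sum_congr rfl fun π _ => ?_).trans
        (sum_perm_eq_zero_of_swap ht p q (fun π => if π l = l then 1 else 0) fun π => by
          rw [Perm.mul_apply, swap_apply_of_ne_of_ne hlp hlq])
      rw [ite_mul, one_mul, zero_mul]
  rw [← Equiv.sum_comp (Equiv.inv (Perm ι))]
  simp only [Equiv.inv_apply, inv_inv, filter_inv_apply_eq]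
  simp_rw [Finset.natCast_card_filter, Finset.sum_mul]
  rw [Finset.sum_comm]
  simp_rw [ite_mul, one_mul, zero_mul]
  exact Finset.sum_eq_zero fun l _ => hl l

end PermSums
end PermStat

/-! ### Eigenvectors of the matrix of a weighted statistic -/

noncomputable section
namespace PermStat
open Matrix Equiv

section Eigenvectors
variable {n : ℕ} {K : Type*} [Field K]

/-- The sign of `u - v`. -/
def sgn (u v : Fin n) : K := if v < u then 1 else if u < v then -1 else 0

theorem sgn_antisymm (u v : Fin n) : (sgn u v : K) = -sgn v u := by
  rcases lt_trichotomy u v with h | rfl | h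
  · simp [sgn, h, h.not_gt]
  · simp [sgn]
  · simp [sgn, h, h.not_gt]

/-- The centred value `2 u - (n - 1)`, as a row sum of `sgn`. -/
def centred (u : Fin n) : K := ∑ v, sgn u v

theorem sum_centred [CharZero K] : ∑ u : Fin n, (centred u : K) = 0 := by
  rw [← self_eq_neg]
  simp only [centred]
  conv_lhs => rw [Finset.sum_comm]
  simp only [← Finset.sum_neg_distrib, ← sgn_antisymm]

theorem centred_eq (u : Fin n) : (centred u : K) = 2 * (u : ℕ) - ((n : K) - 1) := by
  have h : ∀ v : Fin n, (sgn u v : K) =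
      2 * (if v < u then 1 else 0) + (if v = u then 1 else 0) - 1 := by
    intro v
    rcases lt_trichotomy u v with h | rfl | h
    · simp [sgn, h, h.not_gt, h.ne']
    · simp [sgn]
    · simp [sgn, h, h.ne]
      norm_num
  have hcard : (Finset.univ.filter fun v : Fin n => v < u).card = (u : ℕ) := by
    rw [← Fin.card_Iio u]
    congr 1
    ext v
    simp
  simp_rw [centred, h, Finset.sum_sub_distrib, Finset.sum_add_distrib, ← Finset.mul_sum,
    ← Finset.natCast_card_filter, hcard]
  simp [Finset.filter_eq']
  ring

/-- The component of `n • sgn` with zero row sums. -/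
def altPart (u v : Fin n) : K := n * sgn u v - (centred u - centred v)

theorem altPart_antisymm (u v : Fin n) : (altPart u v : K) = -altPart v u := by
  rw [altPart, altPart, sgn_antisymm]
  ring

theorem sum_altPart [CharZero K] (u : Fin n) : ∑ v, (altPart u v : K) = 0 := by
  simp only [altPart, Finset.sum_sub_distrib, sum_centred, ← Finset.mul_sum]
  simp [centred]

theorem altPart_eq {u v : Fin n} (h : u < v) :
    (altPart u v : K) = -(n - 2 * ((v : ℕ) - (u : ℕ))) := by
  rw [altPart, centred_eq, centred_eq]
  simp [sgn, h, h.not_gt]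
  ring

theorem ite_lt_eq_sgn [CharZero K] {u v : Fin n} (h : u ≠ v) :
    (if v < u then 1 else 0 : K) = (1 + sgn u v) / 2 := by
  rcases h.lt_or_gt with h | h
  · simp [sgn, h, h.not_gt]
  · simp [sgn, h]

variable {J : Type*} [Fintype J]

/-- The statistic `∑ c_j [π(a_j) > π(b_j)] + z · #Fix(π)`, for a family of pairs `(a_j, b_j)` with
weights `c_j`. -/
def stat (a b : J → Fin n) (c : J → K) (z : K) (π : Perm (Fin n)) : K :=
  ∑ j, c j * (if π (b j) < π (a j) then 1 else 0) +
    ((Finset.univ.filter fun i => π i = i).card : K) * z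

/-- The matrix `(stat (σ τ⁻¹))`. -/
def statMatrix (a b : J → Fin n) (c : J → K) (z : K) :
    Matrix (Perm (Fin n)) (Perm (Fin n)) K :=
  Matrix.of fun σ τ => stat a b c z (σ * τ⁻¹)

variable {a b : J → Fin n} {c : J → K} {z : K}

theorem statMatrix_mulVec_apply (g : Perm (Fin n) → K) (σ : Perm (Fin n)) :
    (statMatrix a b c z *ᵥ g) σ = ∑ π, stat a b c z π * g (π⁻¹ * σ) := by
  rw [Matrix.mulVec, dotProduct,
    ← Equiv.sum_comp ((Equiv.inv (Perm (Fin n))).trans (Equiv.mulRight σ))]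
  simp [statMatrix]

variable [CharZero K]

theorem stat_eq (hab : ∀ j, a j ≠ b j) (π : Perm (Fin n)) :
    stat a b c z π = (∑ j, c j) / 2 + (∑ j, c j * sgn (π (a j)) (π (b j))) / 2 +
      ((Finset.univ.filter fun i => π i = i).card : K) * z := by
  rw [stat, ← add_div, ← Finset.sum_add_distrib, Finset.sum_div]
  congr 1
  refine Finset.sum_congr rfl fun j _ => ?_
  rw [ite_lt_eq_sgn (π.injective.ne (hab j))]
  ring

theorem sum_stat_mul (hab : ∀ j, a j ≠ b j) (h : Perm (Fin n) → K) :
    ∑ π, stat a b c z π * h π⁻¹ = (∑ j, c j) / 2 * ∑ π, h π +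
      (∑ j, c j * ∑ π : Perm (Fin n), sgn (π (a j)) (π (b j)) * h π⁻¹) / 2 +
      z * ∑ π : Perm (Fin n), ((Finset.univ.filter fun i => π i = i).card : K) * h π⁻¹ := by
  have hinv := Equiv.sum_comp (Equiv.inv (Perm (Fin n))) h
  simp only [Equiv.inv_apply] at hinv
  have hterm : ∀ π : Perm (Fin n), stat a b c z π * h π⁻¹ = (∑ j, c j) / 2 * h π⁻¹ +
      (∑ j, c j * (sgn (π (a j)) (π (b j)) * h π⁻¹)) / 2 +
      z * (((Finset.univ.filter fun i => π i = i).card : K) * h π⁻¹) := by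
    intro π
    have : ∑ j, c j * (sgn (π (a j)) (π (b j)) * h π⁻¹) =
        (∑ j, c j * sgn (π (a j)) (π (b j))) * h π⁻¹ := by
      rw [Finset.sum_mul]
      exact Finset.sum_congr rfl fun j _ => by ring
    rw [stat_eq hab, this]
    ring
  simp_rw [hterm, Finset.sum_add_distrib, ← Finset.sum_div, ← Finset.mul_sum, hinv]
  rw [Finset.sum_comm]
  simp_rw [← Finset.mul_sum]

/-- The sum of all values of `stat`, for weights `c` on pairs of distinct places. -/
def totalEV (n : ℕ) (c : J → K) (z : K) : K := (n ! : K) / 2 * (∑ j, c j) + n ! * z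

/-- The eigenvalue on the functions `u (σ k)` for which `u` has sum zero and zero
`weightPairing`. -/
def fixEV (n : ℕ) (z : K) : K := (n - 2)! * n * z

/-- The functional `u ↦ ∑ c_j (u(a_j) - u(b_j))` defined by the weights. -/
def weightPairing (a b : J → Fin n) (c : J → K) (u : Fin n → K) : K :=
  ∑ j, c j * (u (a j) - u (b j))

/-- The eigenvalue on the functions `centred (σ k)`. -/
def centredEV (a b : J → Fin n) (c : J → K) (z : K) : K :=
  fixEV n z + (n - 2)! * weightPairing a b c centred / 2

/-- The eigenvalue on the functions `altPart (σ k) (σ l)`. -/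
def altEV (a b : J → Fin n) (c : J → K) : K := (n - 3)! * ∑ j, c j * altPart (a j) (b j)

theorem statMatrix_mulVec_one (hn : 1 ≤ n) (hab : ∀ j, a j ≠ b j) :
    statMatrix a b c z *ᵥ 1 = totalEV n c z • 1 := by
  have : Nonempty (Fin n) := ⟨⟨0, hn⟩⟩
  ext σ
  have hfix := sum_perm_card_fixed (ι := Fin n) (K := K)
  have hswap : ∀ j, (∑ π : Perm (Fin n), (sgn (π (a j)) (π (b j)) : K)) = 0 := fun j => by
    simpa using sum_perm_eq_zero_of_swap (K := K) sgn_antisymm (a j) (b j) (fun _ => 1)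
      fun _ => rfl
  have h := sum_stat_mul (c := c) (z := z) hab fun _ => 1
  simp only [mul_one, hfix, hswap, mul_zero, Finset.sum_const_zero] at h
  rw [statMatrix_mulVec_apply]
  simp only [Pi.one_apply, mul_one, h, Pi.smul_apply, smul_eq_mul, totalEV]
  simp [Fintype.card_perm]
  ring

/-- For `u` with sum zero, `statMatrix` multiplies `u (σ k)` by `fixEV` and adds a multiple of
`centred (σ k)`; this rank-one perturbation is what separates `centredEV` from `fixEV`. -/
theorem statMatrix_mulVec_apply_value (hn : 2 ≤ n) (hab : ∀ j, a j ≠ b j) {u : Fin n → K}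
    (hu : ∑ v, u v = 0) (k : Fin n) :
    statMatrix a b c z *ᵥ (fun σ => u (σ k)) = fun σ => fixEV n z * u (σ k) +
      (n - 2)! * weightPairing a b c u / 2 * centred (σ k) := by
  ext σ
  have h := sum_stat_mul (c := c) (z := z) hab fun π => u (π (σ k))
  rw [statMatrix_mulVec_apply]
  simp only [Perm.mul_apply]
  rw [h, sum_perm_apply, hu, sum_perm_card_fixed_mul (by simpa using hn) hu]
  simp_rw [sum_perm_apply_sub sgn_antisymm (hab _), Fintype.card_fin]
  have hw : ∑ j, c j * ((n - 2)! * (u (a j) - u (b j)) * ∑ v, sgn (σ k) v) =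
      (n - 2)! * weightPairing a b c u * centred (σ k) := by
    rw [weightPairing, ← centred, Finset.mul_sum, Finset.sum_mul]
    exact Finset.sum_congr rfl fun j _ => by ring
  rw [hw, fixEV]
  ring

theorem statMatrix_mulVec_centred (hn : 2 ≤ n) (hab : ∀ j, a j ≠ b j) (k : Fin n) :
    statMatrix a b c z *ᵥ (fun σ => centred (σ k)) =
      centredEV a b c z • fun σ => centred (σ k) := by
  rw [statMatrix_mulVec_apply_value hn hab sum_centred]
  ext σ
  simp only [Pi.smul_apply, smul_eq_mul, centredEV]
  ring

theorem statMatrix_mulVec_value (hn : 2 ≤ n) (hab : ∀ j, a j ≠ b j) {u : Fin n → K}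
    (hu : ∑ v, u v = 0) (hc : weightPairing a b c u = 0) (k : Fin n) :
    statMatrix a b c z *ᵥ (fun σ => u (σ k)) = fixEV n z • fun σ => u (σ k) := by
  rw [statMatrix_mulVec_apply_value hn hab hu, hc]
  ext σ
  simp

theorem statMatrix_mulVec_altPart (hn : 3 ≤ n) (hab : ∀ j, a j ≠ b j) (k l : Fin n) :
    statMatrix a b c z *ᵥ (fun σ => altPart (σ k) (σ l)) =
      altEV a b c • fun σ => altPart (σ k) (σ l) := by
  ext σ
  have h := sum_stat_mul (c := c) (z := z) hab fun π => altPart (π (σ k)) (π (σ l))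
  have h0 : ∑ π : Perm (Fin n), (altPart (π (σ k)) (π (σ l)) : K) = 0 := by
    simpa using sum_perm_eq_zero_of_swap (K := K) altPart_antisymm (σ k) (σ l) (fun _ => 1)
      fun _ => rfl
  rw [statMatrix_mulVec_apply]
  simp only [Perm.mul_apply]
  rw [h, h0, sum_perm_card_fixed_mul_alternating altPart_antisymm sum_altPart]
  simp_rw [sum_perm_apply_mul_alternating sgn_antisymm altPart_antisymm sum_altPart
    (by simpa using hn) (hab _), Fintype.card_fin]
  simp only [Pi.smul_apply, smul_eq_mul, altEV, Finset.mul_sum, Finset.sum_mul, Finset.sum_div,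
    mul_zero, zero_add, add_zero]
  refine Finset.sum_congr rfl fun j _ => ?_
  simp only [altPart, centred]
  ring

/-- The columns of `statMatrix` are combinations of the constant function and of the
eigenvectors for `centredEV`, `altEV` and `fixEV`. -/
theorem col_statMatrix_mem (hn : 3 ≤ n) (hab : ∀ j, a j ≠ b j)
    (hne : weightPairing a b c centred ≠ 0) (τ : Perm (Fin n)) :
    (statMatrix a b c z).col τ ∈ Submodule.span K (insert 1
      {v | ∃ l ∈ ({centredEV a b c z, altEV a b c, fixEV n z} : Set K),
        statMatrix a b c z *ᵥ v = l • v}) := by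
  set W := Submodule.span K (insert 1
      {v | ∃ l ∈ ({centredEV a b c z, altEV a b c, fixEV n z} : Set K),
        statMatrix a b c z *ᵥ v = l • v}) with hW
  have hn0 : (n : K) ≠ 0 := Nat.cast_ne_zero.2 (by omega)
  have hone : (1 : Perm (Fin n) → K) ∈ W := Submodule.subset_span (Or.inl rfl)
  have hcent : ∀ k : Fin n, (fun σ : Perm (Fin n) => (centred (σ k) : K)) ∈ W := fun k =>
    Submodule.subset_span (Or.inr ⟨_, by simp, statMatrix_mulVec_centred (by omega) hab k⟩)
  have halt : ∀ k l : Fin n, (fun σ : Perm (Fin n) => (altPart (σ k) (σ l) : K)) ∈ W :=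
    fun k l => Submodule.subset_span (Or.inr ⟨_, by simp, statMatrix_mulVec_altPart hn hab k l⟩)
  -- subtracting a multiple of `centred` from `u` kills the pairing with the weights
  have hval : ∀ (u : Fin n → K), ∑ v, u v = 0 → ∀ k : Fin n,
      (fun σ : Perm (Fin n) => u (σ k)) ∈ W := by
    intro u hu k
    set m := weightPairing a b c u / weightPairing a b c centred with hm
    have hu' : ∑ v, (u v - m * centred v) = 0 := by
      rw [Finset.sum_sub_distrib, ← Finset.mul_sum, sum_centred, hu, mul_zero, sub_zero]
    have hc' : weightPairing a b c (fun v => u v - m * centred v) = 0 := by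
      have : weightPairing a b c (fun v => u v - m * centred v) =
          weightPairing a b c u - m * weightPairing a b c centred := by
        simp only [weightPairing, Finset.mul_sum, ← Finset.sum_sub_distrib]
        exact Finset.sum_congr rfl fun j _ => by ring
      rw [this, hm, div_mul_cancel₀ _ hne, sub_self]
    have h := W.add_mem (Submodule.subset_span (Or.inr ⟨_, by simp,
      statMatrix_mulVec_value (c := c) (z := z) (by omega) hab hu' hc' k⟩))
      (W.smul_mem m (hcent k))
    convert h using 1
    ext σ
    simp
  have hsgn : ∀ k l : Fin n, (fun σ : Perm (Fin n) => (sgn (σ k) (σ l) : K)) ∈ W := by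
    intro k l
    have h := W.smul_mem (n : K)⁻¹ (W.add_mem (halt k l) (W.sub_mem (hcent k) (hcent l)))
    convert h using 1
    ext σ
    simp only [Pi.smul_apply, Pi.add_apply, Pi.sub_apply, altPart, smul_eq_mul]
    field_simp
    ring
  have hind : ∀ k i : Fin n, (fun σ : Perm (Fin n) => if σ k = i then (1 : K) else 0) ∈ W := by
    intro k i
    have h := W.add_mem (hval (fun v => (if v = i then 1 else 0) - (n : K)⁻¹)
      (by simp [Finset.sum_sub_distrib, hn0]) k) (W.smul_mem (n : K)⁻¹ hone)
    convert h using 1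
    ext σ
    simp
  have hcol : (statMatrix a b c z).col τ = ((∑ j, c j) / 2) • (1 : Perm (Fin n) → K) +
      (∑ j, (c j / 2) • (fun σ : Perm (Fin n) => (sgn (σ (τ⁻¹ (a j))) (σ (τ⁻¹ (b j))) : K))) +
      z • ∑ k, fun σ : Perm (Fin n) => if σ (τ⁻¹ k) = k then (1 : K) else 0 := by
    ext σ
    have hfix : ((Finset.univ.filter fun k => (σ * τ⁻¹) k = k).card : K) =
        ∑ k, if σ (τ⁻¹ k) = k then (1 : K) else 0 := Finset.natCast_card_filter _ _
    simp only [Matrix.col_apply, statMatrix, Matrix.of_apply, stat_eq hab, Perm.mul_apply,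
      Pi.add_apply, Pi.smul_apply, Finset.sum_apply, Pi.one_apply, smul_eq_mul, mul_one,
      Finset.sum_div]
    congr 1
    · congr 1
      exact Finset.sum_congr rfl fun j _ => by ring
    · exact (congrArg (· * z) hfix).trans (mul_comm _ _)
  rw [hcol]
  exact W.add_mem (W.add_mem (W.smul_mem _ hone)
    (W.sum_mem fun j _ => W.smul_mem _ (hsgn _ _)))
    (W.smul_mem _ (W.sum_mem fun k _ => hind _ _))

end Eigenvectors
end PermStat
end

/-! ### The indeterminates as weights -/

noncomputable section
namespace PermStat
open Matrix Equiv

section Specialization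
variable {n : ℕ}

/-- The first place of the pair carrying an indeterminate `x_i` or `y_{i,j}`. -/
def lowPlace (j : Fin (n - 1) ⊕ Pair n) : Fin n :=
  j.elim (fun i => ⟨i.val, by have := i.isLt; omega⟩) fun p => p.1.1

/-- The second place of the pair carrying an indeterminate `x_i` or `y_{i,j}`; for `x_i` it is
`i + 1`. -/
def highPlace (j : Fin (n - 1) ⊕ Pair n) : Fin n :=
  j.elim (fun i => ⟨i.val + 1, by have := i.isLt; omega⟩) fun p => p.1.2

theorem lowPlace_lt_highPlace (j : Fin (n - 1) ⊕ Pair n) : lowPlace j < highPlace j := by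
  rcases j with i | p
  · exact Fin.mk_lt_mk.2 (Nat.lt_succ_self _)
  · exact p.2

/-- The indeterminates `x_i` and `y_{i,j}`, `i < j`, in the field of rational functions. -/
def weight (j : Fin (n - 1) ⊕ Pair n) : RatField n :=
  algebraMap (PolyRing n) (RatField n) (j.elim xVar yVar)

theorem algebraMap_stat (π : Perm (Fin n)) :
    algebraMap (PolyRing n) (RatField n) (desX π + invY π + fixZ π) =
      stat lowPlace highPlace weight (algebraMap _ _ (zVar n)) π := by
  have h : ∀ j : Fin (n - 1) ⊕ Pair n, algebraMap (PolyRing n) (RatField n)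
      (if π (highPlace j) < π (lowPlace j) then j.elim xVar yVar else 0) =
        weight j * if π (highPlace j) < π (lowPlace j) then 1 else 0 := by
    intro j
    split_ifs <;> simp [weight]
  simp only [desX, invY, fixZ, Des, Inv, Fix, Finset.sum_filter, map_add, map_sum, map_mul,
    map_natCast]
  rw [stat, Fintype.sum_sum_type]
  congr 2 <;> refine Finset.sum_congr rfl fun i _ => ?_
  · exact h (Sum.inl i)
  · exact h (Sum.inr i)

theorem DIFK_eq_statMatrix :
    DIFK n = statMatrix lowPlace highPlace weight (algebraMap _ _ (zVar n)) := by
  ext σ τ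
  exact algebraMap_stat (σ * τ⁻¹)

theorem trace_DIFK :
    (DIFK n).trace = algebraMap (PolyRing n) (RatField n) ((n ! : ℕ) * n * zVar n) := by
  rw [DIFK_eq_statMatrix, Matrix.trace]
  have h : ∀ σ : Perm (Fin n), (statMatrix lowPlace highPlace weight
      (algebraMap (PolyRing n) (RatField n) (zVar n))).diag σ =
        n * algebraMap (PolyRing n) (RatField n) (zVar n) := by
    intro σ
    simp [statMatrix, stat, (lowPlace_lt_highPlace _).not_gt]
  rw [Finset.sum_congr rfl fun σ _ => h σ]
  simp [Fintype.card_perm, mul_assoc]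

theorem algebraMap_ev1 : algebraMap (PolyRing n) (RatField n) (ev1 n) =
    totalEV n weight (algebraMap _ _ (zVar n)) := by
  have hC : (MvPolynomial.C ((n ! : ℝ) / 2) : PolyRing n) * 2 = (n ! : ℕ) := by
    rw [← map_ofNat MvPolynomial.C 2, ← map_mul, div_mul_cancel₀ _ two_ne_zero, map_natCast]
  have hC' := congrArg (algebraMap (PolyRing n) (RatField n)) hC
  rw [map_mul, map_ofNat, map_natCast] at hC'
  simp only [ev1, totalEV, weight, map_add, map_mul, map_sum, map_natCast, Fintype.sum_sum_type,
    Sum.elim_inl, Sum.elim_inr, ← hC', mul_div_cancel_right₀ _ (two_ne_zero' (RatField n))]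

theorem algebraMap_ev4 : algebraMap (PolyRing n) (RatField n) (ev4 n) =
    fixEV n (algebraMap _ _ (zVar n)) := by
  simp [ev4, fixEV]

theorem algebraMap_ev2 : algebraMap (PolyRing n) (RatField n) (ev2 n) =
    centredEV lowPlace highPlace weight (algebraMap _ _ (zVar n)) := by
  simp only [ev2, centredEV, fixEV, weightPairing, centred_eq, weight, map_add, map_sub, map_neg,
    map_mul, map_sum, map_natCast, Fintype.sum_sum_type, Sum.elim_inl, Sum.elim_inr, lowPlace,
    highPlace, gap]
  have hx : ∀ i : Fin (n - 1), algebraMap (PolyRing n) (RatField n) (xVar i) *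
      (2 * ((i : ℕ) : RatField n) - (n - 1) - (2 * ((i + 1 : ℕ) : RatField n) - (n - 1))) =
        -2 * algebraMap (PolyRing n) (RatField n) (xVar i) := by
    intro i
    push_cast
    ring
  have hy : ∀ p : Pair n, algebraMap (PolyRing n) (RatField n) (yVar p) *
      (2 * ((p.1.1 : ℕ) : RatField n) - (n - 1) - (2 * ((p.1.2 : ℕ) : RatField n) - (n - 1))) =
        -2 * ((((p.1.2 : ℕ) : RatField n) - (p.1.1 : ℕ)) *
          algebraMap (PolyRing n) (RatField n) (yVar p)) := by
    intro p
    ring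
  simp_rw [hx, hy, ← Finset.mul_sum]
  ring

theorem factorial_sub_two (hn : 3 ≤ n) : (n - 2)! = (n - 2) * (n - 3)! := by
  obtain ⟨m, rfl⟩ := Nat.exists_eq_add_of_le' hn
  rfl

theorem algebraMap_ev3 (hn : 3 ≤ n) : algebraMap (PolyRing n) (RatField n) (ev3 n) =
    altEV lowPlace highPlace weight := by
  have halt : ∀ j : Fin (n - 1) ⊕ Pair n, (altPart (lowPlace j) (highPlace j) : RatField n) =
      -(n - 2 * ((highPlace j : ℕ) - (lowPlace j : ℕ))) :=
    fun j => altPart_eq (lowPlace_lt_highPlace j)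
  simp only [altEV, halt]
  simp only [ev3, weight, map_sub, map_neg,
    map_mul, map_sum, map_natCast, map_ofNat, Fintype.sum_sum_type, Sum.elim_inl, Sum.elim_inr,
    lowPlace, highPlace, gap, factorial_sub_two hn]
  have hx : ∀ i : Fin (n - 1), algebraMap (PolyRing n) (RatField n) (xVar i) *
      -((n : RatField n) - 2 * (((i + 1 : ℕ) : RatField n) - (i : ℕ))) =
        -((n - 2 : ℕ) : RatField n) * algebraMap (PolyRing n) (RatField n) (xVar i) := by
    intro i
    rw [Nat.cast_sub (by omega : 2 ≤ n)]
    push_cast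
    ring
  have hy : ∀ p : Pair n, algebraMap (PolyRing n) (RatField n) (yVar p) *
      -((n : RatField n) - 2 * (((p.1.2 : ℕ) : RatField n) - (p.1.1 : ℕ))) =
        -(((n : RatField n) - 2 * (((p.1.2 : ℕ) : RatField n) - (p.1.1 : ℕ))) *
          algebraMap (PolyRing n) (RatField n) (yVar p)) := by
    intro p
    ring
  simp_rw [hx, hy, Finset.sum_neg_distrib, ← Finset.mul_sum]
  push_cast
  ring

/-! ### Coefficients of the eigenvalues, and the trace -/

/-- The specialization `x_i = 1`, all other indeterminates `0`. -/
def atX (n : ℕ) : PolyRing n →+* ℝ :=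
  MvPolynomial.eval fun | .x _ => 1 | .y _ _ _ => 0 | .z => 0

/-- The specialization `y_{0,2} = 1`, all other indeterminates `0`. The gap `2` matters: the
`y_{i,i+1}` have the same coefficients as the `x_i`. -/
def atY (n : ℕ) : PolyRing n →+* ℝ :=
  MvPolynomial.eval fun | .x _ => 0 | .y i j _ => if i.val = 0 ∧ j.val = 2 then 1 else 0 | .z => 0

/-- The specialization `z = 1`, all other indeterminates `0`. -/
def atZ (n : ℕ) : PolyRing n →+* ℝ :=
  MvPolynomial.eval fun | .x _ => 0 | .y _ _ _ => 0 | .z => 1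

theorem atX_xVar (i : Fin (n - 1)) : atX n (xVar i) = 1 := by simp [atX, xVar]
theorem atX_yVar (p : Pair n) : atX n (yVar p) = 0 := by simp [atX, yVar]
theorem atX_zVar : atX n (zVar n) = 0 := by simp [atX, zVar]
theorem atY_xVar (i : Fin (n - 1)) : atY n (xVar i) = 0 := by simp [atY, xVar]
theorem atY_yVar (p : Pair n) :
    atY n (yVar p) = if p.1.1.val = 0 ∧ p.1.2.val = 2 then 1 else 0 := by simp [atY, yVar]
theorem atY_zVar : atY n (zVar n) = 0 := by simp [atY, zVar]
theorem atZ_xVar (i : Fin (n - 1)) : atZ n (xVar i) = 0 := by simp [atZ, xVar]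
theorem atZ_yVar (p : Pair n) : atZ n (yVar p) = 0 := by simp [atZ, yVar]
theorem atZ_zVar : atZ n (zVar n) = 1 := by simp [atZ, zVar]

/-- Evaluating at `y_{0,2} = 1` picks out the term of the pair `(0, 2)`. -/
theorem atY_sum (hn : 3 ≤ n) (g : Pair n → PolyRing n) :
    ∑ p, atY n (g p) * atY n (yVar p) =
      atY n (g ⟨(⟨0, by omega⟩, ⟨2, by omega⟩), Fin.mk_lt_mk.2 two_pos⟩) := by
  rw [Finset.sum_eq_single ⟨(⟨0, by omega⟩, ⟨2, by omega⟩), Fin.mk_lt_mk.2 two_pos⟩]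
  · simp [atY_yVar]
  · rintro ⟨⟨i, j⟩, hij⟩ - hne
    rw [atY_yVar, if_neg, mul_zero]
    rintro ⟨h0, h2⟩
    exact hne (Subtype.ext (Prod.ext (Fin.ext h0) (Fin.ext h2)))
  · simp

theorem cast_factorial (hn : 3 ≤ n) : (n ! : ℝ) = n * (n - 1) * (n - 2) * (n - 3)! := by
  obtain ⟨m, rfl⟩ := Nat.exists_eq_add_of_le' hn
  simp only [Nat.factorial_succ, Nat.add_sub_cancel]
  push_cast
  ring

theorem cast_factorial_sub_two (hn : 3 ≤ n) : ((n - 2)! : ℝ) = (n - 2) * (n - 3)! := by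
  rw [factorial_sub_two hn, Nat.cast_mul, Nat.cast_sub (by omega)]
  norm_num

theorem eval_ev1 (hn : 3 ≤ n) : atX n (ev1 n) = n ! / 2 * (n - 1) ∧ atY n (ev1 n) = n ! / 2 ∧
    atZ n (ev1 n) = n ! := by
  have hy := atY_sum hn fun _ => 1
  simp only [map_one, one_mul] at hy
  have hC : atX n (MvPolynomial.C ((n ! : ℝ) / 2)) = n ! / 2 ∧
      atY n (MvPolynomial.C ((n ! : ℝ) / 2)) = n ! / 2 := by
    constructor <;> simp [atX, atY]
  refine ⟨?_, ?_, ?_⟩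
  · simp [ev1, hC.1, atX_xVar, atX_yVar, atX_zVar, Nat.cast_sub (by omega : 1 ≤ n)]
  · simp [ev1, hC.2, atY_xVar, atY_zVar, hy]
  · simp [ev1, atZ_xVar, atZ_yVar, atZ_zVar]

theorem eval_ev2 (hn : 3 ≤ n) : atX n (ev2 n) = -(n - 2)! * (n - 1) ∧
    atY n (ev2 n) = -(n - 2)! * 2 ∧ atZ n (ev2 n) = (n - 2)! * n := by
  have hy := atY_sum hn gap
  refine ⟨?_, ?_, ?_⟩
  · simp [ev2, atX_xVar, atX_yVar, atX_zVar, Nat.cast_sub (by omega : 1 ≤ n)]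
  · simp [ev2, atY_xVar, atY_zVar, hy]
    simp [gap, map_ofNat]
  · simp [ev2, atZ_xVar, atZ_yVar, atZ_zVar]

theorem eval_ev3 (hn : 3 ≤ n) : atX n (ev3 n) = -(n - 2)! * (n - 1) ∧
    atY n (ev3 n) = -(n - 3)! * (n - 4) ∧ atZ n (ev3 n) = 0 := by
  have hy := atY_sum hn fun p => (n : PolyRing n) - 2 * gap p
  refine ⟨?_, ?_, ?_⟩
  · simp [ev3, atX_xVar, atX_yVar, Nat.cast_sub (by omega : 1 ≤ n)]
  · simp only [ev3, map_sub, map_mul, map_neg, map_sum, map_natCast, atY_xVar] at hy ⊢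
    rw [hy]
    simp [gap, map_ofNat]
    norm_num
  · simp [ev3, atZ_xVar, atZ_yVar]

theorem eval_ev4 : atX n (ev4 n) = 0 ∧ atY n (ev4 n) = 0 ∧ atZ n (ev4 n) = (n - 2)! * n := by
  refine ⟨?_, ?_, ?_⟩ <;> simp [ev4, atX_zVar, atY_zVar, atZ_zVar]

/-- The five eigenvalues are distinct: the coefficient of `z` separates `ev1` from the others and
`{ev2, ev4}` from `{ev3, 0}`, and the coefficients of the `x_i` separate the rest. -/
theorem pairwise_ne_ev (hn : 4 ≤ n) :
    [ev1 n, ev2 n, ev3 n, ev4 n, 0].Pairwise (· ≠ ·) := by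
  obtain ⟨-, -, h1⟩ := eval_ev1 (n := n) (by omega)
  obtain ⟨h2x, -, h2⟩ := eval_ev2 (n := n) (by omega)
  obtain ⟨h3x, -, h3⟩ := eval_ev3 (n := n) (by omega)
  obtain ⟨h4x, -, h4⟩ := eval_ev4 (n := n)
  have hn' : (4 : ℝ) ≤ n := by exact_mod_cast hn
  have hF : (0 : ℝ) < (n - 3)! := by exact_mod_cast Nat.factorial_pos _
  rw [cast_factorial (by omega)] at h1
  rw [cast_factorial_sub_two (by omega)] at h2 h4 h2x h3x
  have hp : (0 : ℝ) < (n - 2) * (n - 3)! := mul_pos (by linarith) hF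
  have h1p : 0 < atZ n (ev1 n) - atZ n (ev2 n) := by
    rw [h1, h2, show (n : ℝ) * (n - 1) * (n - 2) * (n - 3)! - (n - 2) * (n - 3)! * n =
      (n - 2) * (n - 3)! * (n * (n - 2)) by ring]
    exact mul_pos hp (mul_pos (by linarith) (by linarith))
  have h2p : 0 < atZ n (ev2 n) := h2 ▸ mul_pos hp (by linarith)
  have h4p : 0 < atZ n (ev4 n) := h4 ▸ mul_pos hp (by linarith)
  have h24 : atZ n (ev2 n) = atZ n (ev4 n) := h2.trans h4.symm
  have hxp : -((n - 2) * (n - 3)! : ℝ) * (n - 1) < 0 :=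
    mul_neg_of_neg_of_pos (neg_neg_of_pos hp) (by linarith)
  have ne : ∀ {p q : PolyRing n} (f : PolyRing n →+* ℝ), f p ≠ f q → p ≠ q :=
    fun f h e => h (congrArg f e)
  simp only [List.pairwise_cons, List.mem_cons, List.not_mem_nil, or_false, forall_eq_or_imp,
    forall_eq, false_imp_iff, implies_true, List.Pairwise.nil, and_true]
  refine ⟨⟨ne (atZ n) ?_, ne (atZ n) ?_, ne (atZ n) ?_, ne (atZ n) ?_⟩,
    ⟨ne (atZ n) ?_, ne (atX n) ?_, ne (atZ n) ?_⟩, ⟨ne (atZ n) ?_, ne (atX n) ?_⟩, ne (atZ n) ?_⟩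
  · linarith
  · rw [h3]; linarith
  · linarith
  · rw [map_zero]; linarith
  · rw [h3]; linarith
  · rw [h2x, h4x]; exact hxp.ne
  · rw [map_zero]; linarith
  · rw [h3]; linarith
  · rw [h3x, map_zero]; exact hxp.ne
  · rw [map_zero]; linarith

/-- Comparing coefficients in the trace determines the multiplicities, once that of `ev1` is
known to be `1`. -/
theorem mults_of_trace (hn : 4 ≤ n) {m₂ m₃ m₄ : ℕ}
    (h : ((n ! : ℕ) * n * zVar n : PolyRing n) =
      ev1 n + m₂ * ev2 n + m₃ * ev3 n + m₄ * ev4 n) :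
    m₂ = n - 1 ∧ m₃ = (n - 1).choose 2 ∧ m₄ = (n - 1) * (n - 2) := by
  obtain ⟨h1x, h1y, h1z⟩ := eval_ev1 (n := n) (by omega)
  obtain ⟨h2x, h2y, h2z⟩ := eval_ev2 (n := n) (by omega)
  obtain ⟨h3x, h3y, h3z⟩ := eval_ev3 (n := n) (by omega)
  obtain ⟨h4x, h4y, h4z⟩ := eval_ev4 (n := n)
  have hx := congrArg (atX n) h
  have hy := congrArg (atY n) h
  have hz := congrArg (atZ n) h
  simp only [map_add, map_mul, map_natCast, h1x, h1y, h1z, h2x, h2y, h2z, h3x, h3y, h3z, h4x, h4y,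
    h4z, atX_zVar, atY_zVar, atZ_zVar, cast_factorial (by omega : 3 ≤ n),
    cast_factorial_sub_two (by omega : 3 ≤ n)] at hx hy hz
  have hF : ((n - 3)! : ℝ) ≠ 0 := by exact_mod_cast Nat.factorial_ne_zero _
  have hn' : (4 : ℝ) ≤ n := by exact_mod_cast hn
  have hx' : (m₂ : ℝ) + m₃ = n * (n - 1) / 2 := by
    have : (((n - 3)! : ℝ) * (n - 1) * (n - 2)) * (m₂ + m₃ - n * (n - 1) / 2) = 0 := by
      linear_combination hx
    rcases mul_eq_zero.1 this with h | h
    · exact absurd h (mul_ne_zero (mul_ne_zero hF (by linarith)) (by linarith))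
    · linarith
  have hy' : (n : ℝ) * (n - 1) * (n - 2) / 2 = 2 * (n - 2) * m₂ + (n - 4) * m₃ := by
    have : ((n - 3)! : ℝ) *
        (n * (n - 1) * (n - 2) / 2 - (2 * (n - 2) * m₂ + (n - 4) * m₃)) = 0 := by
      linear_combination -hy
    rcases mul_eq_zero.1 this with h | h
    · exact absurd h hF
    · linarith
  have hz' : (n : ℝ) * (n - 1) = (n - 1) + m₂ + m₄ := by
    have : (((n - 3)! : ℝ) * n * (n - 2)) * (n * (n - 1) - ((n - 1) + m₂ + m₄)) = 0 := by
      linear_combination hz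
    rcases mul_eq_zero.1 this with h | h
    · exact absurd h (mul_ne_zero (mul_ne_zero hF (by linarith)) (by linarith))
    · linarith
  have hm2 : (m₂ : ℝ) = n - 1 := by
    have : (n : ℝ) * (m₂ - (n - 1)) = 0 := by
      linear_combination -hy' - (n - 4) * hx'
    rcases mul_eq_zero.1 this with h | h
    · linarith
    · linarith
  have hc1 : ((n - 1 : ℕ) : ℝ) = n - 1 := by
    rw [Nat.cast_sub (by omega), Nat.cast_one]
  refine ⟨?_, ?_, ?_⟩
  · rw [← Nat.cast_inj (R := ℝ), hc1, hm2]
  · rw [← Nat.cast_inj (R := ℝ), Nat.cast_choose_two, hc1]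
    linarith
  · rw [← Nat.cast_inj (R := ℝ), Nat.cast_mul, hc1, Nat.cast_sub (by omega)]
    push_cast
    linarith

/-- The multiplicity of the eigenvalue `0` does not vanish. -/
theorem factorial_sub_ne_zero (hn : 4 ≤ n) :
    (n ! : ℚ) - (n : ℚ) / 2 * (3 * (n : ℚ) - 7) - 3 ≠ 0 := by
  have h1 : (n ! : ℚ) = n * (n - 1) * (n - 2) * (n - 3)! := by
    exact_mod_cast cast_factorial (n := n) (by omega)
  have h2 : (1 : ℚ) ≤ (n - 3)! := by exact_mod_cast Nat.factorial_pos _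
  have h3 : (4 : ℚ) ≤ n := by exact_mod_cast hn
  have h4 : (n : ℚ) * (n - 1) * 2 ≤ n ! := by
    rw [h1]
    calc (n : ℚ) * (n - 1) * 2 ≤ n * (n - 1) * (n - 2) := by
          apply mul_le_mul_of_nonneg_left (by linarith)
          exact mul_nonneg (by linarith) (by linarith)
      _ ≤ _ := le_mul_of_one_le_right
          (mul_nonneg (mul_nonneg (by linarith) (by linarith)) (by linarith)) h2
  have h5 : (0 : ℚ) < n * n := mul_pos (by linarith) (by linarith)
  apply ne_of_gt
  linarith

end Specialization

end PermStat
end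

open PermStat in
theorem corollary1p2 (n : ℕ) (hn : 4 ≤ n) :
    PermStat.IsDiagonalizable (PermStat.DIFK n) ∧
    spectrum (PermStat.RatField n) (PermStat.DIFK n) =
      algebraMap (PermStat.PolyRing n) (PermStat.RatField n) ''
        {PermStat.ev1 n, PermStat.ev2 n, PermStat.ev3 n, PermStat.ev4 n, 0} ∧
    (spectrum (PermStat.RatField n) (PermStat.DIFK n)).ncard = 5 ∧
    PermStat.mult (PermStat.DIFK n) (algebraMap _ _ (PermStat.ev1 n)) = 1 ∧
    PermStat.mult (PermStat.DIFK n) (algebraMap _ _ (PermStat.ev2 n)) = n - 1 ∧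
    PermStat.mult (PermStat.DIFK n) (algebraMap _ _ (PermStat.ev3 n)) = (n - 1).choose 2 ∧
    PermStat.mult (PermStat.DIFK n) (algebraMap _ _ (PermStat.ev4 n)) = (n - 1) * (n - 2) ∧
    (PermStat.mult (PermStat.DIFK n) 0 : ℚ) =
      (n ! : ℚ) - (n : ℚ) / 2 * (3 * (n : ℚ) - 7) - 3 := by
  classical
  have hinj : Function.Injective (algebraMap (PolyRing n) (RatField n)) :=
    IsFractionRing.injective _ _
  have hpoly := pairwise_ne_ev hn
  have hne : ([ev1 n, ev2 n, ev3 n, ev4 n, 0].map (algebraMap (PolyRing n) (RatField n))).Pairwise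
      (· ≠ ·) := List.Pairwise.map _ (fun _ _ h => hinj.ne h) hpoly
  simp only [List.map_cons, List.map_nil, List.pairwise_cons, List.mem_cons, List.not_mem_nil,
    or_false, forall_eq_or_imp, forall_eq, false_imp_iff, implies_true, List.Pairwise.nil,
    and_true, map_zero] at hne
  obtain ⟨⟨h12, h13, h14, h10⟩, ⟨h23, h24, h20⟩, ⟨h34, h30⟩, h40⟩ := hne
  have hab : ∀ j : Fin (n - 1) ⊕ Pair n, lowPlace j ≠ highPlace j :=
    fun j => (lowPlace_lt_highPlace j).ne
  have hpair : weightPairing lowPlace highPlace (weight (n := n)) centred ≠ 0 := by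
    intro h
    apply h24
    rw [algebraMap_ev2, algebraMap_ev4, centredEV, h]
    simp
  obtain ⟨P, d, hP, hMP, hd, hcard⟩ := exists_diagonalization (DIFK n) 1
    (algebraMap _ _ (ev1 n))
    {algebraMap _ _ (ev2 n), algebraMap _ _ (ev3 n), algebraMap _ _ (ev4 n)}
    (by rw [algebraMap_ev1, DIFK_eq_statMatrix]; exact statMatrix_mulVec_one (by omega) hab)
    one_ne_zero h10 (by simp [h20.symm, h30.symm, h40.symm]) (by simp [h12, h13, h14])
    (by
      rw [DIFK_eq_statMatrix, algebraMap_ev2, algebraMap_ev3 (by omega), algebraMap_ev4]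
      exact col_statMatrix_mem (by omega) hab hpair)
  have hmem : ∀ i, d i ∈ ({algebraMap _ _ (ev1 n), algebraMap _ _ (ev2 n),
      algebraMap _ _ (ev3 n), algebraMap _ _ (ev4 n), 0} : Finset (RatField n)) := by
    intro i
    have := hd i
    simp only [Set.mem_insert_iff, Set.mem_singleton_iff] at this
    simp only [Finset.mem_insert, Finset.mem_singleton]
    rcases this with h | h | h | h | h
    · exact Or.inl h
    · exact Or.inr (Or.inr (Or.inr (Or.inr h)))
    · exact Or.inr (Or.inl h)
    · exact Or.inr (Or.inr (Or.inl h))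
    · exact Or.inr (Or.inr (Or.inr (Or.inl h)))
  have hexpand : ∀ {A : Type} [AddCommMonoid A] (F : RatField n → A), ∑ i, F (d i) =
      F (algebraMap _ _ (ev1 n)) +
      (mult (DIFK n) (algebraMap _ _ (ev2 n)) • F (algebraMap _ _ (ev2 n)) +
      (mult (DIFK n) (algebraMap _ _ (ev3 n)) • F (algebraMap _ _ (ev3 n)) +
      (mult (DIFK n) (algebraMap _ _ (ev4 n)) • F (algebraMap _ _ (ev4 n)) +
      mult (DIFK n) 0 • F 0))) := by
    intro A _ F
    rw [sum_eq_sum_card_filter hmem, Finset.sum_insert, Finset.sum_insert, Finset.sum_insert,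
      Finset.sum_insert, Finset.sum_singleton, hcard, one_smul]
    · simp only [mult_eq_card hP hMP]
    · simp only [Finset.mem_singleton]
      exact h40
    · simp only [Finset.mem_insert, Finset.mem_singleton, not_or]
      exact ⟨h34, h30⟩
    · simp only [Finset.mem_insert, Finset.mem_singleton, not_or]
      exact ⟨h23, h24, h20⟩
    · simp only [Finset.mem_insert, Finset.mem_singleton, not_or]
      exact ⟨h12, h13, h14, h10⟩
  have hm1 : mult (DIFK n) (algebraMap _ _ (ev1 n)) = 1 := by
    rw [mult_eq_card hP hMP, hcard]
  have htrace := (trace_eq_sum hP hMP).symm.trans trace_DIFK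
  rw [hexpand fun a => a] at htrace
  obtain ⟨hm2, hm3, hm4⟩ := mults_of_trace hn (m₂ := mult (DIFK n) (algebraMap _ _ (ev2 n)))
    (m₃ := mult (DIFK n) (algebraMap _ _ (ev3 n)))
    (m₄ := mult (DIFK n) (algebraMap _ _ (ev4 n))) (hinj (by
      rw [← htrace]
      simp only [map_add, map_mul, map_natCast, nsmul_eq_mul]
      ring))
  have htotal := hexpand fun _ => (1 : ℕ)
  simp only [smul_eq_mul, mul_one, Finset.sum_const, Finset.card_univ, Fintype.card_perm,
    Fintype.card_fin, hm2, hm3, hm4] at htotal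
  have hc1 : ((n - 1 : ℕ) : ℚ) = n - 1 := by rw [Nat.cast_sub (by omega), Nat.cast_one]
  have hc2 : ((n - 2 : ℕ) : ℚ) = n - 2 := by
    rw [Nat.cast_sub (by omega), Nat.cast_ofNat]
  have hm0 : (mult (DIFK n) 0 : ℚ) = (n ! : ℚ) - (n : ℚ) / 2 * (3 * (n : ℚ) - 7) - 3 := by
    have := congrArg (Nat.cast : ℕ → ℚ) htotal
    push_cast [Nat.cast_choose_two, hc1, hc2] at this
    linear_combination -this
  have hpos : ∀ a, mult (DIFK n) a ≠ 0 → a ∈ Set.range d := by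
    intro a ha
    rw [mult_eq_card hP hMP, Finset.card_ne_zero] at ha
    obtain ⟨i, hi⟩ := ha
    exact ⟨i, (Finset.mem_filter.1 hi).2⟩
  have hm0' : mult (DIFK n) 0 ≠ 0 := by
    intro h
    rw [h] at hm0
    exact factorial_sub_ne_zero hn (hm0.symm.trans Nat.cast_zero)
  have hspec : spectrum (RatField n) (DIFK n) =
      algebraMap (PolyRing n) (RatField n) '' {ev1 n, ev2 n, ev3 n, ev4 n, 0} := by
    rw [spectrum_eq_range hP hMP]
    simp only [Set.image_insert_eq, Set.image_singleton, map_zero]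
    apply Set.Subset.antisymm
    · rintro _ ⟨i, rfl⟩
      simpa using hmem i
    · rintro a (rfl | rfl | rfl | rfl | rfl) <;> apply hpos
      · rw [hm1]; exact one_ne_zero
      · rw [hm2]; omega
      · rw [hm3]; exact (Nat.choose_pos (by omega)).ne'
      · rw [hm4]; exact Nat.mul_ne_zero (by omega) (by omega)
      · exact hm0'
  refine ⟨⟨P, d, hP, inv_mul_mul_eq_diagonal hP hMP⟩, hspec, ?_, hm1, hm2, hm3, hm4, hm0⟩
  rw [hspec, Set.ncard_image_of_injective _ hinj]
  simp only [List.pairwise_cons, List.mem_cons, List.not_mem_nil, or_false, forall_eq_or_imp,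
    forall_eq, false_imp_iff, implies_true, List.Pairwise.nil, and_true] at hpoly
  obtain ⟨⟨p12, p13, p14, p10⟩, ⟨p23, p24, p20⟩, ⟨p34, p30⟩, p40⟩ := hpoly
  rw [Set.ncard_insert_of_notMem (by simp [p12, p13, p14, p10]),
    Set.ncard_insert_of_notMem (by simp [p23, p24, p20]),
    Set.ncard_insert_of_notMem (by simp [p34, p30]), Set.ncard_pair p40]
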